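/- Let $K$ be a field and let $A$ be a finite-dimensional associative unital $K$-algebra that is connected ($A \neq 0$ and its only central idempotents are $0$ and $1$), not semisimple, and basic (no direct summand of the right module $A_A$ is isomorphic to $P \oplus P$ with $P$ an indecomposable projective right module). Assume that $A$ is selfinjective, i.e. that $A_A$ is an injective right module. Then: 1. $A$ is standardly stratified if and only if $A$ is local. 2. $A$ is not quasi-hereditary. Here $J$ denotes the Jacobson radical of $A$. For an ordered complete sequence $E = (e_1, \dots, e_n)$ of primitive orthogonal idempotents of $A$ (so $e_1 + \dots + e_n = 1$), the proper standard right modules are $$\bar\Delta(i) = e_iA / e_iJ(e_i + e_{i+1} + \dots + e_n)A, \qquad 1 \le i \le n.$$ The algebra $A$ is called *standardly stratified* if for some such ordered sequence $E$ the right module $A_A$ has a finite filtration by submodules all of whose subquotients are isomorphic to modules among $\bar\Delta(1), \dots, \bar\Delta(n)$. It is called *quasi-hereditary* if it is standardly stratified and has finite global dimension, where the global dimension is the supremum of the projective dimensions of the finite-dimensional right $A$-modules. -/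

import Mathlib

open scoped MulOpposite

/-! A right `A`-module is a module over `Aᵐᵒᵖ`; the regular right module `A_A` is `A` with
Mathlib's action `MulOpposite.op a • x = x * a`. -/

namespace StdStrat

universe u

section Algebras

variable (A : Type u) [Ring A]

/-- `A` is connected: it is nonzero and its only central idempotents are `0` and `1`, that is,
`A` is not a product of two nonzero algebras. -/
def IsConnectedAlg : Prop :=
  Nontrivial A ∧ ∀ c : A, IsIdempotentElem c → (∀ a : A, c * a = a * c) → c = 0 ∨ c = 1

/-- A module is indecomposable: it is nonzero and it is not the direct sum of two nonzero
submodules. -/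
def IsIndecomposableModule (R M : Type*) [Ring R] [AddCommGroup M] [Module R M] : Prop :=
  Nontrivial M ∧ ∀ N N' : Submodule R M, IsCompl N N' → N = ⊥ ∨ N' = ⊥

/-- `A` is basic: no direct summand of the regular right module is isomorphic to `P ⊕ P`
with `P` an indecomposable projective right module. -/
def IsBasicAlg : Prop :=
  ¬ ∃ (P : Type u) (_ : AddCommGroup P) (_ : Module Aᵐᵒᵖ P),
    Module.Projective Aᵐᵒᵖ P ∧ IsIndecomposableModule Aᵐᵒᵖ P ∧
      ∃ N N' : Submodule Aᵐᵒᵖ A, IsCompl N N' ∧ Nonempty ((P × P) ≃ₗ[Aᵐᵒᵖ] N)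

/-- `A` is selfinjective: the regular right module is injective. -/
def IsSelfinjectiveAlg : Prop :=
  Module.Injective Aᵐᵒᵖ A

/-- The right global dimension of `A`: the supremum of the projective dimensions of the finitely
generated right `A`-modules (for a finite dimensional algebra, these are exactly the finite
dimensional ones). -/
noncomputable def globalDimension : WithBot ℕ∞ :=
  ⨆ (M : ModuleCat.{u} Aᵐᵒᵖ) (_ : Module.Finite Aᵐᵒᵖ M),
    CategoryTheory.projectiveDimension M

end Algebras

/-- A primitive idempotent: a nonzero idempotent that is not the sum of two nonzero orthogonal
idempotents. -/
def IsPrimitiveIdempotent {A : Type u} [Ring A] (e : A) : Prop :=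
  IsIdempotentElem e ∧ e ≠ 0 ∧
    ∀ f g : A, IsIdempotentElem f → IsIdempotentElem g → f * g = 0 → g * f = 0 →
      e = f + g → f = 0 ∨ g = 0

/-- `e = (e 0, …, e (n - 1))` is an ordered complete sequence of primitive orthogonal idempotents:
they are primitive, pairwise orthogonal, and sum up to `1`. -/
def IsCompletePrimitiveSeq {A : Type u} [Ring A] {n : ℕ} (e : Fin n → A) : Prop :=
  CompleteOrthogonalIdempotents e ∧ ∀ i, IsPrimitiveIdempotent (e i)

section ProperStandard

variable {A : Type u} [Ring A] {n : ℕ} (e : Fin n → A) (i : Fin n)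

/-- The right ideal `e_i A`. -/
def projectiveIdeal : Submodule Aᵐᵒᵖ A :=
  Submodule.span Aᵐᵒᵖ {e i}

/-- The right ideal `e_i J (e_i + e_{i+1} + ⋯ + e_n) A`, where `J` is the Jacobson radical. -/
def properTraceIdeal : Submodule Aᵐᵒᵖ A :=
  Submodule.span Aᵐᵒᵖ {x : A | ∃ r ∈ Ring.jacobson A, x = e i * r * ∑ j ∈ Finset.Ici i, e j}

/-- The proper standard right module
`Δ̄(i) = e_i A / e_i J (e_i + e_{i+1} + ⋯ + e_n) A`. -/
abbrev ProperStandard : Type u :=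
  ↥(projectiveIdeal e i) ⧸ (properTraceIdeal e i).submoduleOf (projectiveIdeal e i)

end ProperStandard

/-- `M` has a finite filtration `0 = F 0 ⊆ F 1 ⊆ ⋯ ⊆ F s = M` all of whose subquotients
`F (k + 1) / F k` are isomorphic to members of the family `C`. -/
def IsFilteredBy {R ι : Type*} [Ring R] (C : ι → Type*) [∀ i, AddCommGroup (C i)]
    [∀ i, Module R (C i)] (M : Type*) [AddCommGroup M] [Module R M] : Prop :=
  ∃ (s : ℕ) (F : ℕ → Submodule R M), F 0 = ⊥ ∧ F s = ⊤ ∧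
    ∀ k < s, F k ≤ F (k + 1) ∧
      ∃ i, Nonempty ((↥(F (k + 1)) ⧸ (F k).submoduleOf (F (k + 1))) ≃ₗ[R] C i)

/-- `A` is standardly stratified: for some ordered complete sequence of primitive orthogonal
idempotents, the regular right module has a filtration by proper standard modules. -/
def IsStandardlyStratified (A : Type u) [Ring A] : Prop :=
  ∃ (n : ℕ) (e : Fin n → A), IsCompletePrimitiveSeq e ∧
    IsFilteredBy (R := Aᵐᵒᵖ) (fun i => ProperStandard e i) A

/-- `A` is quasi-hereditary: it is standardly stratified and has finite global dimension. -/
def IsQuasiHereditary (A : Type u) [Ring A] : Prop :=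
  IsStandardlyStratified A ∧ globalDimension A < ⊤

end StdStrat

/-! Let e be the last idempotent, so that Δ̄ at e is eA/eJeA; put d = dim eAe/eJe and δ = dim
eA/eJeA. Since A is basic, the other proper standard modules are killed by e. Hence only copies of
Δ̄ at e build up Ae: each adds at most d to dim Ae and at least δ to dim AeA, so δ·dim Ae ≤ d·dim
AeA (`finrank_leftSpace_mul_le`). Building Ae from simple eAe-modules gives the opposite bound
(`finrank_mul_rightSpace_le`). Equality forces each nonzero x in Ae with x·eJe = 0 to have
annihilator exactly eJeA in eA (`mem_traceSpace_of_mul_eq_zero`).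

If (1-e)Ae ≠ 0, such elements exist in both eAe and (1-e)Ae. By selfinjectivity each is a left
multiple of the other, yet (1-e)Ae lies in J because A is basic, so they vanish
(`one_sub_mul_mul_eq_zero`). The Nakayama permutation and one more extension of a homomorphism then
give eA(1-e) = 0 (`mul_mul_one_sub_eq_zero`). So e is central, e = 1 by connectedness, and A = eAe
is local by Fitting's lemma. Conversely, over a local A a composition series is a filtration by
Δ̄(1) = A/J.

For the second claim, finitely generated modules of finite projective dimension over a selfinjective
algebra are projective, so finite global dimension would make A semisimple. -/

namespace StdStrat

/-! ### Nilpotency of the radical and Fitting's lemma. -/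

section Artinian

variable {A : Type*} [Ring A]

/-- A left ideal consisting of nilpotent elements lies in the Jacobson radical. -/
theorem mem_jacobson_of_forall_isNilpotent {x : A} (h : ∀ y : A, IsNilpotent (y * x)) :
    x ∈ Ring.jacobson A := by
  rw [← Ideal.jacobson_bot, Ideal.mem_jacobson_iff]
  intro y
  have h1 : IsUnit (1 + y * x) := (h y).isUnit_one_add
  obtain ⟨u, hu⟩ := h1
  refine ⟨(↑u⁻¹ : A), ?_⟩
  have := u.inv_mul
  rw [hu, mul_add, mul_one, ← mul_assoc] at this
  rw [Ideal.mem_bot]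
  rw [add_comm] at this
  rw [this, sub_self]

theorem exists_jacobson_pow_eq_bot [IsArtinianRing A] : ∃ k, Ring.jacobson A ^ k = ⊥ :=
  IsSemiprimaryRing.isNilpotent

theorem isNilpotent_of_mem_jacobson [IsArtinianRing A] {x : A} (hx : x ∈ Ring.jacobson A) :
    IsNilpotent x := by
  obtain ⟨k, hk⟩ := exists_jacobson_pow_eq_bot (A := A)
  refine ⟨k, ?_⟩
  have := Ideal.pow_mem_pow hx k
  rwa [hk] at this

theorem mul_mem_jacobson {x : A} (hx : x ∈ Ring.jacobson A) (a b : A) :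
    a * x * b ∈ Ring.jacobson A :=
  Ideal.mul_mem_right b _ (Ideal.mul_mem_left _ a hx)

theorem isNilpotent_mul_comm {x y : A} (h : IsNilpotent (x * y)) : IsNilpotent (y * x) := by
  obtain ⟨k, hk⟩ := h
  refine ⟨k + 1, ?_⟩
  have : ∀ m, (y * x) ^ (m + 1) = y * (x * y) ^ m * x := by
    intro m
    induction m with
    | zero => simp
    | succ m ih => rw [pow_succ, ih, pow_succ]; simp only [mul_assoc]
  rw [this, hk]; simp

/-- The Fitting decomposition for the corner of a primitive idempotent. -/
theorem isNilpotent_or_exists_inverse [IsArtinianRing A] [IsNoetherian Aᵐᵒᵖ A]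
    [IsArtinian Aᵐᵒᵖ A] {e x : A} (he : IsPrimitiveIdempotent e)
    (hl : e * x = x) (hr : x * e = x) :
    IsNilpotent x ∨ ∃ y, e * y = y ∧ y * e = y ∧ x * y = e ∧ y * x = e := by
  obtain ⟨hid, h0, hprim⟩ := he
  let L : A →ₗ[Aᵐᵒᵖ] A :=
    { toFun := fun a => x * a
      map_add' := mul_add x
      map_smul' := fun c a => by simp [mul_assoc] }
  have hL : ∀ k a, (L ^ k) a = x ^ k * a := by
    intro k
    induction k with
    | zero => simp
    | succ k ih => intro a; rw [pow_succ', Module.End.mul_apply, ih, pow_succ', mul_assoc]; rfl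
  obtain ⟨k, hk⟩ := Filter.eventually_atTop.1 L.eventually_isCompl_ker_pow_range_pow
  -- A positive exponent is needed: then e absorbs the power of x on both sides.
  have hc := hk (k + 1) (Nat.le_succ k)
  have hex : ∀ m, e * x ^ (m + 1) = x ^ (m + 1) := fun m => by rw [pow_succ', ← mul_assoc, hl]
  have hxe : ∀ m, x ^ (m + 1) * e = x ^ (m + 1) := fun m => by rw [pow_succ, mul_assoc, hr]
  have kerMem : ∀ a, a ∈ (L ^ (k + 1)).ker ↔ x ^ (k + 1) * a = 0 := by
    intro a; rw [LinearMap.mem_ker, hL]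
  have rngMem : ∀ a, a ∈ (L ^ (k + 1)).range ↔ ∃ w, x ^ (k + 1) * w = a := by
    intro a; simp [LinearMap.mem_range, hL]
  have huniq : ∀ a b a' b', x ^ (k + 1) * a = 0 → x ^ (k + 1) * a' = 0 →
      (∃ w, x ^ (k + 1) * w = b) → (∃ w, x ^ (k + 1) * w = b') → a + b = a' + b' →
      a = a' ∧ b = b' := by
    rintro a b a' b' ha ha' ⟨w, hw⟩ ⟨w', hw'⟩ hab
    have h1 : a - a' = b' - b := by rw [sub_eq_sub_iff_add_eq_add, hab, add_comm]
    have h2 : a - a' ∈ (L ^ (k + 1)).ker ⊓ (L ^ (k + 1)).range := by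
      refine ⟨(kerMem _).2 (by rw [mul_sub, ha, ha', sub_zero]), (rngMem _).2 ⟨w' - w, ?_⟩⟩
      rw [mul_sub, hw, hw', h1]
    rw [hc.inf_eq_bot, Submodule.mem_bot] at h2
    exact ⟨sub_eq_zero.1 h2, (sub_eq_zero.1 (h1 ▸ h2)).symm⟩
  obtain ⟨u, hu, v, hv, huv⟩ := Submodule.mem_sup.1
    (show e ∈ (L ^ (k + 1)).ker ⊔ (L ^ (k + 1)).range by rw [hc.sup_eq_top]; trivial)
  rw [kerMem] at hu
  obtain ⟨w, hw⟩ := (rngMem _).1 hv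
  have hev : e * v = v := by rw [← hw, ← mul_assoc, hex]
  have heu : e * u = u := by
    have : u = e - v := by rw [← huv, add_sub_cancel_right]
    rw [this, mul_sub, hid.eq, hev]
  have huu := huniq (u * u) (v * u) u 0 (by rw [← mul_assoc, hu, zero_mul]) hu
    ⟨w * u, by rw [← mul_assoc, hw]⟩ ⟨0, mul_zero _⟩
    (by rw [← add_mul, huv, heu, add_zero])
  have hvv := huniq (u * v) (v * v) 0 v (by rw [← mul_assoc, hu, zero_mul]) (mul_zero _)
    ⟨w * v, by rw [← mul_assoc, hw]⟩ ⟨w, hw⟩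
    (by rw [← add_mul, huv, hev, zero_add])
  rcases hprim u v huu.1 hvv.2 hvv.1 huu.2 huv.symm with h | h
  · right
    rw [h, zero_add] at huv
    let y := e * (x ^ k * w) * e
    have hy1 : e * y = y := by simp only [y, ← mul_assoc, hid.eq]
    have hy2 : y * e = y := by simp only [y, mul_assoc, hid.eq]
    have hxy : x * y = e := by
      simp only [y]
      rw [← mul_assoc, ← mul_assoc, hr, ← mul_assoc x, ← pow_succ', hw, huv, hid.eq]
    refine ⟨y, hy1, hy2, hxy, ?_⟩
    -- Adding 1 - e moves the right inverse from eAe to A, where one-sided inverses are two-sided.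
    have h1 : (x + (1 - e)) * (y + (1 - e)) = 1 := by
      simp only [add_mul, mul_add, mul_sub, sub_mul, mul_one, one_mul, hxy, hr, hy1, hid.eq]
      abel
    have h2 := mul_eq_one_symm h1
    simp only [add_mul, mul_add, mul_sub, sub_mul, mul_one, one_mul, hy2, hl, hid.eq, sub_self,
      add_zero, add_sub_cancel_left] at h2
    have h3 : y * x + (1 - e) = 1 := h2
    rw [add_sub, sub_eq_iff_eq_add] at h3
    exact add_right_cancel (h3.trans (add_comm _ _))
  · left
    rw [h, add_zero] at huv
    exact ⟨k + 1, by rw [← hxe, ← huv, hu]⟩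

end Artinian

/-! ### Local corners of primitive idempotents. -/

section Corner

variable {A : Type*} [Ring A] {e : A}

theorem not_isNilpotent_idempotent (h : IsIdempotentElem e) (h0 : e ≠ 0) : ¬ IsNilpotent e := by
  rintro ⟨k, hk⟩
  cases k with
  | zero => rw [pow_zero] at hk; exact h0 (by rw [← mul_one e, hk, mul_zero])
  | succ k => rw [h.pow_succ_eq] at hk; exact h0 hk

variable [IsArtinianRing A] [IsNoetherian Aᵐᵒᵖ A] [IsArtinian Aᵐᵒᵖ A]

/-- A one-sided inverse in the corner of a primitive idempotent is excluded by nilpotency. -/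
theorem isNilpotent_of_mul_ne (he : IsPrimitiveIdempotent e) {x : A}
    (hl : e * x = x) (hr : x * e = x) (h : ∀ y, x * y ≠ e) : IsNilpotent x := by
  rcases isNilpotent_or_exists_inverse he hl hr with h' | ⟨y, -, -, hy, -⟩
  · exact h'
  · exact absurd hy (h y)

/-- For each y, the element eyx of eAe is not invertible there: cancelling it would descend from x^k
= 0 to e = 0. So eyx is nilpotent, and then so is yx. -/
theorem corner_mem_jacobson (he : IsPrimitiveIdempotent e) {x : A}
    (hl : e * x = x) (hr : x * e = x) (hx : IsNilpotent x) : x ∈ Ring.jacobson A := by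
  refine mem_jacobson_of_forall_isNilpotent fun y => ?_
  have h1 : IsNilpotent (e * (y * x)) := by
    rcases isNilpotent_or_exists_inverse he (x := e * (y * x))
      (by rw [← mul_assoc, he.1.eq]) (by rw [mul_assoc, mul_assoc, hr]) with h | ⟨z, -, hz, -, h⟩
    · exact h
    · exfalso
      obtain ⟨k, hk⟩ := hx
      have key : ∀ m, x ^ m = 0 → e = 0 := by
        intro m
        induction m with
        | zero => intro hm; rw [pow_zero] at hm; rw [← mul_one e, hm, mul_zero]
        | succ m ih =>
          intro hm
          refine ih ?_
          cases m with
          | zero =>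
            rw [zero_add, pow_one] at hm
            rw [hm] at h
            exact absurd (by simpa using h.symm) he.2.1
          | succ m =>
            calc x ^ (m + 1) = e * x ^ (m + 1) := by rw [pow_succ', ← mul_assoc, hl]
              _ = z * (e * (y * x)) * x ^ (m + 1) := by rw [h]
              _ = z * e * y * x ^ (m + 1 + 1) := by rw [pow_succ' x (m + 1)]; simp only [mul_assoc]
              _ = 0 := by rw [hm, mul_zero]
      exact he.2.1 (key k hk)
  have h2 := isNilpotent_mul_comm h1
  rwa [mul_assoc, hr] at h2

/-- An element of `e A e` outside the Jacobson radical is invertible in `e A e`. -/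
theorem exists_inverse_of_notMem_jacobson (he : IsPrimitiveIdempotent e) {x : A}
    (hl : e * x = x) (hr : x * e = x) (hx : x ∉ Ring.jacobson A) :
    ∃ y, e * y = y ∧ y * e = y ∧ x * y = e ∧ y * x = e :=
  (isNilpotent_or_exists_inverse he hl hr).resolve_left
    fun h => hx (corner_mem_jacobson he hl hr h)

omit [IsNoetherian Aᵐᵒᵖ A] [IsArtinian Aᵐᵒᵖ A] in
theorem notMem_jacobson_of_primitive (he : IsPrimitiveIdempotent e) : e ∉ Ring.jacobson A :=
  fun h => not_isNilpotent_idempotent he.1 he.2.1 (isNilpotent_of_mem_jacobson h)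

/-- An element of `e A` outside the Jacobson radical generates `e A`. -/
theorem exists_mul_eq_of_notMem_jacobson (he : IsPrimitiveIdempotent e) {x : A}
    (hl : e * x = x) (hx : x ∉ Ring.jacobson A) : ∃ y, x * y = e := by
  by_contra! h
  refine hx (mem_jacobson_of_forall_isNilpotent fun y => ?_)
  have h1 : IsNilpotent (x * (y * e)) :=
    isNilpotent_of_mul_ne he (by rw [← mul_assoc, hl]) (by rw [mul_assoc, mul_assoc, he.1.eq])
      fun z => by rw [mul_assoc]; exact h _
  have h2 := isNilpotent_mul_comm h1
  rwa [mul_assoc, hl] at h2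

end Corner

universe u

/-! ### Right ideals, basic algebras and selfinjectivity. -/

section RightIdeals

variable {A : Type u} [Ring A]

theorem op_smul_mem {I : Submodule Aᵐᵒᵖ A} {x : A} (hx : x ∈ I) (a : A) : x * a ∈ I :=
  I.smul_mem (MulOpposite.op a) hx

theorem mem_span_singleton_op {x y : A} :
    y ∈ Submodule.span Aᵐᵒᵖ {x} ↔ ∃ a, x * a = y := by
  rw [Submodule.mem_span_singleton]
  exact ⟨fun ⟨c, hc⟩ => ⟨c.unop, hc⟩, fun ⟨a, ha⟩ => ⟨MulOpposite.op a, ha⟩⟩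

theorem mem_span_idempotent {e x : A} (he : IsIdempotentElem e) :
    x ∈ Submodule.span Aᵐᵒᵖ {e} ↔ e * x = x := by
  rw [mem_span_singleton_op]
  exact ⟨fun ⟨a, ha⟩ => by rw [← ha, ← mul_assoc, he.eq], fun h => ⟨x, h⟩⟩

/-- Left multiplication as an endomorphism of the regular right module. -/
def mulLeftOp (a : A) : A →ₗ[Aᵐᵒᵖ] A where
  toFun x := a * x
  map_add' := mul_add a
  map_smul' c x := by simp [mul_assoc]

@[simp] theorem mulLeftOp_apply (a x : A) : mulLeftOp a x = a * x := rfl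

/-- The regular right module is free of rank one. -/
def regularEquiv (A : Type u) [Ring A] : Aᵐᵒᵖ ≃ₗ[Aᵐᵒᵖ] A where
  toFun c := c.unop
  invFun := MulOpposite.op
  left_inv _ := rfl
  right_inv _ := rfl
  map_add' _ _ := rfl
  map_smul' _ _ := rfl

instance : Module.Projective Aᵐᵒᵖ A := Module.Projective.of_equiv (regularEquiv A)

instance : Module.Finite Aᵐᵒᵖ A := Module.Finite.equiv (regularEquiv A)

theorem isCompl_span_idempotent {e : A} (he : IsIdempotentElem e) :
    IsCompl (Submodule.span Aᵐᵒᵖ {e}) (Submodule.span Aᵐᵒᵖ {1 - e}) := by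
  constructor
  · rw [Submodule.disjoint_def]
    intro x h1 h2
    rw [mem_span_idempotent he] at h1
    rw [mem_span_idempotent he.one_sub, sub_mul, one_mul, h1, sub_self] at h2
    exact h2.symm
  · rw [codisjoint_iff, eq_top_iff]
    intro x _
    have : x = e * x + (1 - e) * x := by rw [sub_mul, one_mul, add_sub_cancel]
    rw [this]
    exact Submodule.add_mem_sup (mem_span_singleton_op.2 ⟨x, rfl⟩)
      (mem_span_singleton_op.2 ⟨x, rfl⟩)

theorem projective_span_idempotent {e : A} (he : IsIdempotentElem e) :
    Module.Projective Aᵐᵒᵖ (Submodule.span Aᵐᵒᵖ {e}) := by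
  refine Module.Projective.of_split (Submodule.subtype _)
    ((mulLeftOp e).codRestrict _ fun x => mem_span_singleton_op.2 ⟨x, rfl⟩) ?_
  ext x
  exact (mem_span_idempotent he).1 x.2

/-- Uniqueness of components makes the two parts of e orthogonal idempotents, so one of them is
zero. -/
theorem isIndecomposable_span_primitive {e : A} (he : IsPrimitiveIdempotent e) :
    IsIndecomposableModule Aᵐᵒᵖ (Submodule.span Aᵐᵒᵖ {e}) := by
  obtain ⟨hid, h0, hp⟩ := he
  have heM := Submodule.mem_span_singleton_self (R := Aᵐᵒᵖ) e
  refine ⟨⟨⟨⟨e, heM⟩, 0, fun h => h0 (congrArg Subtype.val h)⟩⟩, fun N N' hN => ?_⟩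
  obtain ⟨f, hf, g, hg, hfg⟩ := Submodule.mem_sup.1
    (show (⟨e, heM⟩ : Submodule.span Aᵐᵒᵖ {e}) ∈ N ⊔ N' by rw [hN.sup_eq_top]; trivial)
  have huniq : ∀ a ∈ N, ∀ b ∈ N', ∀ a' ∈ N, ∀ b' ∈ N', a + b = a' + b' → a = a' ∧ b = b' := by
    intro a ha b hb a' ha' b' hb' h
    have h1 : a - a' = b' - b := by rw [sub_eq_sub_iff_add_eq_add, h, add_comm]
    have h2 : a - a' ∈ N ⊓ N' := ⟨N.sub_mem ha ha', h1 ▸ N'.sub_mem hb' hb⟩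
    rw [hN.inf_eq_bot, Submodule.mem_bot] at h2
    exact ⟨sub_eq_zero.1 h2, (sub_eq_zero.1 (h1 ▸ h2)).symm⟩
  have hsum : (f : A) + g = e := congrArg Subtype.val hfg
  have hmul : ∀ x : Submodule.span Aᵐᵒᵖ {e}, (f : A) * x + g * x = x := fun x => by
    rw [← add_mul, hsum, (mem_span_idempotent hid).1 x.2]
  have hf' := huniq (MulOpposite.op (f : A) • f) (N.smul_mem _ hf) (MulOpposite.op (f : A) • g)
    (N'.smul_mem _ hg) f hf 0 N'.zero_mem (Subtype.ext (by simpa using hmul f))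
  have hg' := huniq (MulOpposite.op (g : A) • f) (N.smul_mem _ hf) (MulOpposite.op (g : A) • g)
    (N'.smul_mem _ hg) 0 N.zero_mem g hg (Subtype.ext (by simpa using hmul g))
  rcases hp f g (congrArg Subtype.val hf'.1) (congrArg Subtype.val hg'.2)
    (congrArg Subtype.val hg'.1) (congrArg Subtype.val hf'.2) hsum.symm with h | h
  · left
    rw [eq_bot_iff]
    intro x hx
    have hx' : (g : A) * x = x := by have := hmul x; rwa [h, zero_mul, zero_add] at this
    have : x ∈ N' := by
      have h3 : MulOpposite.op (x : A) • g = x := Subtype.ext hx'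
      rw [← h3]; exact N'.smul_mem _ hg
    exact hN.inf_eq_bot ▸ (⟨hx, this⟩ : x ∈ N ⊓ N')
  · right
    rw [eq_bot_iff]
    intro x hx
    have hx' : (f : A) * x = x := by have := hmul x; rwa [h, zero_mul, add_zero] at this
    have : x ∈ N := by
      have h3 : MulOpposite.op (x : A) • f = x := Subtype.ext hx'
      rw [← h3]; exact N.smul_mem _ hf
    exact hN.inf_eq_bot ▸ (⟨this, hx⟩ : x ∈ N ⊓ N')

/-- In a basic algebra, the projectives of orthogonal primitive idempotents are not isomorphic. -/
theorem mul_mem_jacobson_of_isBasicAlg [IsArtinianRing A] [IsNoetherian Aᵐᵒᵖ A]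
    [IsArtinian Aᵐᵒᵖ A] (hA : IsBasicAlg A) {e f : A} (he : IsPrimitiveIdempotent e)
    (hf : IsPrimitiveIdempotent f) (hef : e * f = 0) (hfe : f * e = 0) {a b : A}
    (hfa : f * a = a) (hae : a * e = a) (heb : e * b = b) (hbf : b * f = b) :
    b * a ∈ Ring.jacobson A := by
  by_contra hba
  obtain ⟨y, hy1, hy2, -, hy⟩ := exists_inverse_of_notMem_jacobson he
    (by rw [← mul_assoc, heb]) (by rw [mul_assoc, hae]) hba
  rw [← mul_assoc] at hy
  have hec : e * (y * b) = y * b := by rw [← mul_assoc, hy1]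
  have hcf : y * b * f = y * b := by rw [mul_assoc, hbf]
  generalize y * b = c at hy hec hcf
  -- Since ca = e, the product ac is a nonzero idempotent of fAf, and primitivity of f leaves only
  -- f.
  have hac : a * c = f := by
    have hi : IsIdempotentElem (a * c) := by
      rw [IsIdempotentElem, mul_assoc, ← mul_assoc c, hy, hec]
    have h1 : f * (a * c) = a * c := by rw [← mul_assoc, hfa]
    have h2 : a * c * f = a * c := by rw [mul_assoc, hcf]
    rcases hf.2.2 (a * c) (f - a * c) hi
      (by rw [IsIdempotentElem, sub_mul, mul_sub, mul_sub, hf.1.eq, h1, h2, hi.eq, sub_self,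
        sub_zero])
      (by rw [mul_sub, h2, hi.eq, sub_self]) (by rw [sub_mul, h1, hi.eq, sub_self])
      (by rw [add_sub_cancel]) with h | h
    · exfalso
      have : e * e = 0 := by
        calc e * e = c * a * (c * a) := by rw [hy]
          _ = c * (a * c) * a := by simp only [mul_assoc]
          _ = 0 := by rw [h, mul_zero, zero_mul]
      exact he.2.1 (he.1.eq ▸ this)
    · exact (sub_eq_zero.1 h).symm
  have hg : IsIdempotentElem (e + f) := by
    rw [IsIdempotentElem, add_mul, mul_add, mul_add, hef, hfe, he.1.eq, hf.1.eq, add_zero,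
      zero_add]
  have hea : e * a = 0 := by rw [← hfa, ← mul_assoc, hef, zero_mul]
  have hce : c * e = 0 := by rw [← hcf, mul_assoc, hfe, mul_zero]
  refine hA ⟨Submodule.span Aᵐᵒᵖ {e}, inferInstance, inferInstance,
    projective_span_idempotent he.1, isIndecomposable_span_primitive he, _, _,
    isCompl_span_idempotent hg, ⟨?_⟩⟩
  -- The map eA × eA → (e + f)A is (p, q) ↦ p + aq, with inverse x ↦ (ex, cx).
  refine LinearEquiv.ofLinearMap
    ((LinearMap.coprod (Submodule.subtype _) (mulLeftOp a ∘ₗ Submodule.subtype _)).codRestrict _ ?_)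
    (LinearMap.prod
      (((mulLeftOp e) ∘ₗ Submodule.subtype _).codRestrict _ ?_)
      (((mulLeftOp c) ∘ₗ Submodule.subtype _).codRestrict _ ?_)) ?_ ?_
  · rintro ⟨p, q⟩
    have hp := (mem_span_idempotent he.1).1 p.2
    rw [mem_span_idempotent hg]
    simp only [LinearMap.coprod_apply, Submodule.subtype_apply, LinearMap.comp_apply,
      mulLeftOp_apply]
    have hfp : f * (p : A) = 0 := by rw [← hp, ← mul_assoc, hfe, zero_mul]
    rw [add_mul, mul_add, mul_add, hp, hfp, ← mul_assoc, ← mul_assoc, hea, hfa]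
    simp
  · intro x; exact mem_span_singleton_op.2 ⟨_, rfl⟩
  · intro x
    rw [mem_span_idempotent he.1]
    simp only [LinearMap.comp_apply, mulLeftOp_apply]
    rw [← mul_assoc, hec]
  · ext x
    have hx := (mem_span_idempotent hg).1 x.2
    change e * (x : A) + a * (c * (x : A)) = x
    rw [← mul_assoc, hac, ← add_mul, hx]
  · refine LinearMap.ext fun ⟨p, q⟩ => Prod.ext (Subtype.ext ?_) (Subtype.ext ?_)
    · have hp := (mem_span_idempotent he.1).1 p.2
      simp [mul_add, hp, ← mul_assoc, hea]
    · have hp := (mem_span_idempotent he.1).1 p.2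
      have hq := (mem_span_idempotent he.1).1 q.2
      have hcp : c * (p : A) = 0 := by rw [← hp, ← mul_assoc, hce, zero_mul]
      simp [mul_add, hcp, ← mul_assoc, hy, hq]

theorem exists_forall_eq_mul_left (h : IsSelfinjectiveAlg A) {I : Submodule Aᵐᵒᵖ A}
    (f : I →ₗ[Aᵐᵒᵖ] A) : ∃ c, ∀ x : I, f x = c * x := by
  obtain ⟨g, hg⟩ := Module.Injective.out (self := h) I.subtype I.injective_subtype f
  refine ⟨g 1, fun x => ?_⟩
  rw [← hg, ← MulOpposite.unop_op (x : A), ← op_smul_eq_mul, MulOpposite.unop_op, ← map_smul]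
  simp

/-- The map xa ↦ ya is well defined on xA, and its extension to A is a left multiplication. -/
theorem exists_mul_left_eq (h : IsSelfinjectiveAlg A) {x y : A}
    (hxy : ∀ a, x * a = 0 → y * a = 0) : ∃ c, c * x = y := by
  have hmem : ∀ z : Submodule.span Aᵐᵒᵖ {x}, ∃ a, x * a = z := fun z =>
    mem_span_singleton_op.1 z.2
  choose s hs using hmem
  have key : ∀ a b, x * a = x * b → y * a = y * b := fun a b hab => by
    rw [← sub_eq_zero, ← mul_sub]
    exact hxy _ (by rw [mul_sub, hab, sub_self])
  obtain ⟨c, hc⟩ := exists_forall_eq_mul_left h (I := Submodule.span Aᵐᵒᵖ {x})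
    { toFun := fun z => y * s z
      map_add' := fun z w => by
        rw [← mul_add]; exact key _ _ (by rw [mul_add, hs, hs, hs]; rfl)
      map_smul' := fun r z => by
        change _ = y * s z * r.unop
        rw [mul_assoc]; exact key _ _ (by rw [← mul_assoc, hs, hs]; rfl) }
  refine ⟨c, ?_⟩
  have h1 := hc ⟨x, Submodule.mem_span_singleton_self x⟩
  refine h1.symm.trans ?_
  change y * s _ = y
  rw [key _ 1 (by rw [hs, mul_one]), mul_one]

/-- Two elements of `A e`, lying in `f A` and `g A`, with the same annihilator in `e A`. -/
theorem exists_mul_left_eq_corner (h : IsSelfinjectiveAlg A) {e f g x y : A}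
    (hxe : x * e = x) (hye : y * e = y) (hfx : f * x = x) (hgy : g * y = y)
    (hxy : ∀ a, e * a = a → x * a = 0 → y * a = 0) (he : IsIdempotentElem e) :
    ∃ c, g * c * f * x = y := by
  obtain ⟨c, hc⟩ := exists_mul_left_eq h (x := x) (y := y) fun a ha => by
    rw [← hye, mul_assoc]
    exact hxy _ (by rw [← mul_assoc, he.eq]) (by rw [← mul_assoc, hxe, ha])
  exact ⟨c, by rw [mul_assoc, hfx, mul_assoc, hc, hgy]⟩

end RightIdeals

/-! ### Dimension counts for induced maps on subquotients. -/

section Finrank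

open Module

variable {K V W : Type*} [Field K] [AddCommGroup V] [Module K V] [AddCommGroup W] [Module K W]
  [FiniteDimensional K V] [FiniteDimensional K W]

omit [FiniteDimensional K W] in
theorem finrank_map_add_finrank_inf_ker (φ : V →ₗ[K] W) (U : Submodule K V) :
    finrank K (U.map φ) + finrank K (U ⊓ φ.ker : Submodule K V) = finrank K U := by
  have h := LinearMap.finrank_range_add_finrank_ker (φ.domRestrict U)
  rw [LinearMap.range_domRestrict] at h
  rw [← h, LinearMap.ker_domRestrict, add_right_inj]
  rw [← Submodule.map_comap_subtype]
  exact (LinearEquiv.finrank_eq (Submodule.equivMapOfInjective _ U.injective_subtype _)).symm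

/-- V'/U maps onto (X + φ(V'))/X, which bounds Y/X. -/
theorem finrank_add_le_of_le_sup_map (φ : V →ₗ[K] W) {U V' : Submodule K V} {X Y : Submodule K W}
    (hUV : U ≤ V') (hU : U.map φ ≤ X) (hY : Y ≤ X ⊔ V'.map φ) :
    finrank K Y + finrank K U ≤ finrank K X + finrank K V' := by
  have h1 := Submodule.finrank_sup_add_finrank_inf_eq X (V'.map φ)
  have h2 := Submodule.finrank_mono hY
  have h3 := Submodule.finrank_mono (le_inf hU (Submodule.map_mono (f := φ) hUV))
  have h4 := finrank_map_add_finrank_inf_ker φ U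
  have h5 := finrank_map_add_finrank_inf_ker φ V'
  have h6 := Submodule.finrank_mono (inf_le_inf_right φ.ker hUV)
  omega

/-- V' modulo V' ∩ φ⁻¹(X) embeds in Y/X, and the subspace divided out lies in U. -/
theorem finrank_add_le_of_map_le (φ : V →ₗ[K] W) {U V' : Submodule K V} {X Y : Submodule K W}
    (hXY : X ≤ Y) (hV : V'.map φ ≤ Y) (hU : ∀ v ∈ V', φ v ∈ X → v ∈ U) :
    finrank K X + finrank K V' ≤ finrank K Y + finrank K U := by
  have h1 := Submodule.finrank_sup_add_finrank_inf_eq X (V'.map φ)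
  have h2 := Submodule.finrank_mono (sup_le hXY hV)
  have h3 : X ⊓ V'.map φ = (V' ⊓ X.comap φ).map φ := by
    ext w
    constructor
    · rintro ⟨hw, v, hv, rfl⟩
      exact ⟨v, ⟨hv, hw⟩, rfl⟩
    · rintro ⟨v, ⟨hv, hv'⟩, rfl⟩
      exact ⟨hv', v, hv, rfl⟩
  have h4 := finrank_map_add_finrank_inf_ker φ (V' ⊓ X.comap φ)
  have h5 := finrank_map_add_finrank_inf_ker φ V'
  have h6 : V' ⊓ X.comap φ ⊓ φ.ker = V' ⊓ φ.ker := by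
    ext v
    simp only [Submodule.mem_inf, Submodule.mem_comap, LinearMap.mem_ker]
    exact ⟨fun h => ⟨h.1.1, h.2⟩, fun h => ⟨⟨h.1, h.2 ▸ X.zero_mem⟩, h.2⟩⟩
  have h7 := Submodule.finrank_mono
    (show V' ⊓ X.comap φ ≤ U from fun v hv => hU v hv.1 hv.2)
  rw [h3] at h1
  rw [h6] at h4
  omega

end Finrank

/-! ### Comparing dim Y with dim Y·eA for eAe-submodules Y of Ae. -/

section Corners

open Module

variable (K : Type*) {A : Type*} [Field K] [Ring A] [Algebra K A] (e : A)

/-- The subspace `e A`. -/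
def rightSpace : Submodule K A := LinearMap.eqLocus (LinearMap.mulLeft K e) LinearMap.id

/-- The subspace `A e`. -/
def leftSpace : Submodule K A := LinearMap.eqLocus (LinearMap.mulRight K e) LinearMap.id

/-- The subspace `e A e`. -/
def cornerSpace : Submodule K A := rightSpace K e ⊓ leftSpace K e

/-- The radical `e J e` of `e A e`. -/
def cornerRadical : Submodule K A := cornerSpace K e ⊓ (Ring.jacobson A).restrictScalars K

/-- The subspace `e J e A`. -/
def traceSpace : Submodule K A := cornerRadical K e * rightSpace K e

variable {K} {e} {x : A}

theorem mem_rightSpace : x ∈ rightSpace K e ↔ e * x = x := Iff.rfl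

theorem mem_leftSpace : x ∈ leftSpace K e ↔ x * e = x := Iff.rfl

theorem mul_mem_rightSpace (hx : x ∈ rightSpace K e) (y : A) : x * y ∈ rightSpace K e := by
  rw [mem_rightSpace] at *
  rw [← mul_assoc, hx]

theorem mul_mem_leftSpace (hx : x ∈ leftSpace K e) (y : A) : y * x ∈ leftSpace K e := by
  rw [mem_leftSpace] at *
  rw [mul_assoc, hx]

theorem cornerRadical_le : cornerRadical K e ≤ cornerSpace K e := inf_le_left

theorem traceSpace_le : traceSpace K e ≤ rightSpace K e := by
  rw [traceSpace, Submodule.mul_le]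
  intro m hm n _
  exact mul_mem_rightSpace hm.1.1 n

variable (K A) in
theorem isNoetherian_op [FiniteDimensional K A] : IsNoetherian Aᵐᵒᵖ A := isNoetherian_of_tower K inferInstance

variable (K A) in
theorem isArtinian_op [FiniteDimensional K A] : IsArtinian Aᵐᵒᵖ A := isArtinian_of_tower K inferInstance

theorem map_mulLeft_traceSpace_le {y : A} {X : Submodule K A}
    (h : (cornerRadical K e).map (LinearMap.mulLeft K y) ≤ X) :
    (traceSpace K e).map (LinearMap.mulLeft K y) ≤ X * rightSpace K e := by
  rw [Submodule.map_le_iff_le_comap, traceSpace, Submodule.mul_le]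
  intro m hm n hn
  rw [Submodule.mem_comap, LinearMap.mulLeft_apply, ← mul_assoc]
  exact Submodule.mul_mem_mul (h ⟨m, hm, rfl⟩) hn

variable [FiniteDimensional K A]

variable (K) in
-- Otherwise q is invertible in eAe, and multiplying yq by its inverse puts y in X.
theorem mem_of_mul_mem (he : IsPrimitiveIdempotent e) {X : Submodule K A}
    (hX : X * cornerSpace K e ≤ X) {y q : A} (hye : y * e = y) (hy : y ∉ X)
    (hq : q ∈ cornerSpace K e) (hyq : y * q ∈ X) : q ∈ cornerRadical K e := by
  have := IsArtinianRing.of_finite K A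
  have := isNoetherian_op K A
  have := isArtinian_op K A
  refine ⟨hq, ?_⟩
  by_contra hqJ
  obtain ⟨z, hz1, hz2, hz, -⟩ := exists_inverse_of_notMem_jacobson he hq.1 hq.2 hqJ
  apply hy
  rw [← hye, ← hz, ← mul_assoc]
  exact hX (Submodule.mul_mem_mul hyq ⟨hz1, hz2⟩)

/-- In a nonzero right module over `e A e` there is an element killed by the radical, relative to
a proper submodule. -/
theorem exists_mul_cornerRadical_le {X Y : Submodule K A} (hXY : X < Y)
    (hY : Y * cornerSpace K e ≤ Y) :
    ∃ y ∈ Y, y ∉ X ∧ (cornerRadical K e).map (LinearMap.mulLeft K y) ≤ X := by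
  have := IsArtinianRing.of_finite K A
  obtain ⟨y₀, hy₀, hy₀X⟩ := SetLike.exists_of_lt hXY
  obtain ⟨k, hk⟩ := exists_jacobson_pow_eq_bot (A := A)
  by_contra! h
  have key : ∀ m, ∃ y ∈ Y, y ∉ X ∧ ∃ a ∈ Ring.jacobson A ^ m, ∃ b, y = b * a := by
    intro m
    induction m with
    | zero => exact ⟨y₀, hy₀, hy₀X, 1, by simp [Submodule.pow_zero], y₀, by simp⟩
    | succ m ih =>
      obtain ⟨y, hy, hyX, a, ha, b, rfl⟩ := ih
      obtain ⟨w, ⟨n, hn, rfl⟩, hw⟩ := SetLike.not_le_iff_exists.1 (h _ hy hyX)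
      refine ⟨_, hY (Submodule.mul_mem_mul hy (cornerRadical_le hn)), hw, a * n, ?_, b,
        mul_assoc _ _ _⟩
      rw [Submodule.pow_succ]
      exact Ideal.mul_mem_mul ha hn.2
  obtain ⟨y, -, hyX, a, ha, b, rfl⟩ := key k
  rw [hk, Ideal.mem_bot] at ha
  exact hyX (by rw [ha, mul_zero]; exact X.zero_mem)

omit [FiniteDimensional K A] in
theorem cornerSpace_mul_self_le : cornerSpace K e * cornerSpace K e ≤ cornerSpace K e := by
  rw [Submodule.mul_le]
  intro m hm n hn
  exact ⟨mul_mem_rightSpace hm.1 n, mul_mem_leftSpace hn.2 m⟩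

/-- Climb from X to Y by adjoining y·eAe with y killed by eJe modulo X: each step adds at least d to
dim X and at most δ to dim X·eA. -/
theorem finrank_mul_rightSpace_le (he : IsPrimitiveIdempotent e) {d δ : ℕ}
    (hd : finrank K (cornerSpace K e) = finrank K (cornerRadical K e) + d)
    (hδ : finrank K (rightSpace K e) = finrank K (traceSpace K e) + δ)
    {Y : Submodule K A} (hY : Y * cornerSpace K e ≤ Y) (hYe : Y ≤ leftSpace K e)
    (X : Submodule K A) (hX : X * cornerSpace K e ≤ X) (hXY : X ≤ Y) :
    d * finrank K (Y * rightSpace K e : Submodule K A) + finrank K X * δ ≤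
      d * finrank K (X * rightSpace K e : Submodule K A) + finrank K Y * δ := by
  induction X using WellFoundedGT.induction with
  | ind X ih =>
    rcases hXY.eq_or_lt with rfl | hlt
    · exact le_rfl
    obtain ⟨y, hy, hyX, hyN⟩ := exists_mul_cornerRadical_le hlt hY
    have hye : y * e = y := hYe hy
    let X' := X ⊔ (cornerSpace K e).map (LinearMap.mulLeft K y)
    have hmap : (cornerSpace K e).map (LinearMap.mulLeft K y) ≤ Y := by
      rw [Submodule.map_le_iff_le_comap]
      exact fun q hq => hY (Submodule.mul_mem_mul hy hq)
    have hXX' : X < X' := by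
      refine lt_of_le_of_ne le_sup_left fun h => hyX ?_
      rw [h]
      exact Submodule.mem_sup_right ⟨e, ⟨he.1.eq, he.1.eq⟩, hye⟩
    have hX' : X' * cornerSpace K e ≤ X' := by
      rw [Submodule.sup_mul]
      refine sup_le_sup hX ?_
      rw [Submodule.mul_le]
      rintro _ ⟨q, hq, rfl⟩ q' hq'
      exact ⟨q * q', cornerSpace_mul_self_le (Submodule.mul_mem_mul hq hq'), (mul_assoc _ _ _).symm⟩
    have h1 := ih X' hXX' hX' (sup_le hXY hmap)
    have h2 := finrank_add_le_of_map_le (LinearMap.mulLeft K y) hXX'.le le_sup_right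
      fun q hq hyq => mem_of_mul_mem K he hX hye hyX hq hyq
    have h3 := finrank_add_le_of_le_sup_map (LinearMap.mulLeft K y) (traceSpace_le (K := K) (e := e))
      (map_mulLeft_traceSpace_le hyN) (Y := X' * rightSpace K e) (by
        rw [Submodule.sup_mul]
        refine sup_le_sup le_rfl ?_
        rw [Submodule.mul_le]
        rintro _ ⟨q, hq, rfl⟩ p _
        exact ⟨q * p, mul_mem_rightSpace hq.1 p, (mul_assoc _ _ _).symm⟩)
    have h4 : finrank K X + d ≤ finrank K X' := by omega
    have h5 : finrank K (X' * rightSpace K e : Submodule K A) ≤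
      finrank K (X * rightSpace K e : Submodule K A) + δ := by omega
    have h6 := Nat.mul_le_mul_right δ h4
    have h7 := Nat.mul_le_mul_left d h5
    rw [add_mul] at h6
    rw [mul_add] at h7
    omega

/-- If `A e A` is as large as the length of `A e` over `e A e` permits, then every nonzero
element of `A e` killed by `e J e` has annihilator `e J e A` in `e A`. -/
theorem mem_traceSpace_of_mul_eq_zero (he : IsPrimitiveIdempotent e) {d δ : ℕ}
    (hd : finrank K (cornerSpace K e) = finrank K (cornerRadical K e) + d)
    (hδ : finrank K (rightSpace K e) = finrank K (traceSpace K e) + δ)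
    (hA : finrank K (leftSpace K e) * δ ≤
      d * finrank K (leftSpace K e * rightSpace K e : Submodule K A))
    {x a : A} (hxe : x * e = x) (hx0 : x ≠ 0) (hx : ∀ n ∈ cornerRadical K e, x * n = 0)
    (ha : e * a = a) (hxa : x * a = 0) : a ∈ traceSpace K e := by
  have := IsArtinianRing.of_finite K A
  let X := (cornerSpace K e).map (LinearMap.mulLeft K x)
  have hdpos : 0 < d := by
    have : cornerRadical K e < cornerSpace K e := by
      refine lt_of_le_of_ne cornerRadical_le fun h => notMem_jacobson_of_primitive he ?_
      have h1 : e ∈ cornerSpace K e := ⟨he.1.eq, he.1.eq⟩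
      rw [← h] at h1
      exact h1.2
    have := Submodule.finrank_lt_finrank_of_lt this
    omega
  have hleft : leftSpace K e * cornerSpace K e ≤ leftSpace K e := by
    rw [Submodule.mul_le]
    intro m _ n hn
    exact mul_mem_leftSpace hn.2 m
  -- For X = x·eAe inside Ae, this bound and `hA` give δ·dim X ≤ d·dim X·eA. As dim X ≥ d, the space
  -- x·eA has dimension at least δ, so its kernel in eA is no larger than eJeA.
  have h1 := finrank_mul_rightSpace_le he hd hδ hleft le_rfl X (by
      rw [Submodule.mul_le]
      rintro _ ⟨q, hq, rfl⟩ q' hq'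
      exact ⟨q * q', cornerSpace_mul_self_le (Submodule.mul_mem_mul hq hq'),
        (mul_assoc _ _ _).symm⟩) (by
      rintro _ ⟨q, hq, rfl⟩
      exact mul_mem_leftSpace hq.2 x)
  have h2 := finrank_add_le_of_map_le (LinearMap.mulLeft K x) (X := ⊥) (Y := X) bot_le le_rfl
    fun q hq hxq => mem_of_mul_mem K he (X := ⊥) (by rw [Submodule.bot_mul]) hxe hx0 hq hxq
  rw [finrank_bot] at h2
  have h3 : finrank K (X * rightSpace K e : Submodule K A) ≤
      finrank K ((rightSpace K e).map (LinearMap.mulLeft K x)) := by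
    refine Submodule.finrank_mono ?_
    rw [Submodule.mul_le]
    rintro _ ⟨q, hq, rfl⟩ p _
    exact ⟨q * p, mul_mem_rightSpace hq.1 p, (mul_assoc _ _ _).symm⟩
  have h4 : δ ≤ finrank K ((rightSpace K e).map (LinearMap.mulLeft K x)) := by
    have h5 : d * δ ≤ finrank K X * δ := Nat.mul_le_mul_right δ (by omega)
    have h6 := Nat.mul_le_mul_left d h3
    exact Nat.le_of_mul_le_mul_left (by omega) hdpos
  have h5 := finrank_map_add_finrank_inf_ker (LinearMap.mulLeft K x) (rightSpace K e)
  have h6 : traceSpace K e ≤ rightSpace K e ⊓ (LinearMap.mulLeft K x).ker := by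
    refine le_inf traceSpace_le ?_
    rw [traceSpace, Submodule.mul_le]
    intro m hm n _
    rw [LinearMap.mem_ker, LinearMap.mulLeft_apply, ← mul_assoc, hx m hm, zero_mul]
  rw [Submodule.eq_of_le_of_finrank_le h6 (by omega)]
  exact ⟨ha, hxa⟩

end Corners

/-! ### Proper standard filtrations at the last idempotent. -/

section Sequence

open Module

variable {A : Type u} [Ring A]

/-- Basicness puts eyf·x in J, so it is nilpotent; cycling the factors makes yx nilpotent for every
y. -/
theorem mem_jacobson_of_orthogonal [IsArtinianRing A] [IsNoetherian Aᵐᵒᵖ A]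
    [IsArtinian Aᵐᵒᵖ A] (hA : IsBasicAlg A) {e f : A} (he : IsPrimitiveIdempotent e)
    (hf : IsPrimitiveIdempotent f) (hef : e * f = 0) (hfe : f * e = 0) {x : A}
    (hfx : f * x = x) (hxe : x * e = x) : x ∈ Ring.jacobson A := by
  refine mem_jacobson_of_forall_isNilpotent fun y => ?_
  have h1 : e * y * f * x ∈ Ring.jacobson A :=
    mul_mem_jacobson_of_isBasicAlg hA he hf hef hfe hfx hxe
      (by simp only [← mul_assoc, he.1.eq]) (by rw [mul_assoc, hf.1.eq])
  rw [mul_assoc, mul_assoc, hfx] at h1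
  have h2 := isNilpotent_mul_comm (isNilpotent_of_mem_jacobson h1)
  rwa [mul_assoc, hxe] at h2

theorem eq_zero_of_mul_eq_self [IsArtinianRing A] {z x : A} (hz : z ∈ Ring.jacobson A)
    (h : z * x = x) : x = 0 := by
  obtain ⟨k, hk⟩ := isNilpotent_of_mem_jacobson hz
  have : ∀ m, z ^ m * x = x := by
    intro m
    induction m with
    | zero => simp
    | succ m ih => rw [pow_succ, mul_assoc, h, ih]
  rw [← this k, hk, zero_mul]

variable {n : ℕ} {e : Fin n → A}

theorem IsCompletePrimitiveSeq.mul_eq_zero (he : IsCompletePrimitiveSeq e) {i j : Fin n}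
    (h : i ≠ j) : e i * e j = 0 :=
  he.1.ortho h

theorem mem_properTraceIdeal_of_mem_jacobson (he : IsCompletePrimitiveSeq e) {i j : Fin n}
    (hij : i ≤ j) {x : A} (hx : x ∈ Ring.jacobson A) (hix : e i * x = x) (hxj : x * e j = x) :
    x ∈ properTraceIdeal e i := by
  have h1 : (∑ k ∈ Finset.Ici i, e k) * e j = e j := by
    rw [Finset.sum_mul, Finset.sum_eq_single j]
    · exact (he.2 j).1.eq
    · intro k _ hk; exact he.mul_eq_zero hk
    · intro h; exact absurd (Finset.mem_Ici.2 hij) h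
  have h2 : e i * x * (∑ k ∈ Finset.Ici i, e k) ∈ properTraceIdeal e i :=
    Submodule.subset_span ⟨x, hx, rfl⟩
  have h3 := op_smul_mem h2 (e j)
  rwa [mul_assoc, h1, mul_assoc, hxj, hix] at h3

/-- The top of a proper standard subquotient, described by elements. -/
theorem exists_generator_of_equiv (he : IsCompletePrimitiveSeq e) {i : Fin n}
    {F F' : Submodule Aᵐᵒᵖ A}
    (φ : (↥F' ⧸ F.submoduleOf F') ≃ₗ[Aᵐᵒᵖ] ProperStandard e i) :
    ∃ g ∈ F', g * e i = g ∧ (∀ x ∈ F', ∃ a, e i * a = a ∧ x - g * a ∈ F) ∧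
      ∀ a, e i * a = a → (g * a ∈ F ↔ a ∈ properTraceIdeal e i) := by
  have hid := (he.2 i).1
  have hmem : ∀ a, e i * a = a → a ∈ projectiveIdeal e i := fun a ha =>
    (mem_span_idempotent hid).2 ha
  let q (a : A) (ha : e i * a = a) : ProperStandard e i := Submodule.Quotient.mk ⟨a, hmem a ha⟩
  obtain ⟨g₀, hg₀⟩ := Submodule.Quotient.mk_surjective _ (φ.symm (q (e i) hid))
  have hsmul : ∀ a (ha : e i * a = a), Submodule.Quotient.mk (MulOpposite.op a • g₀) =
      φ.symm (q a ha) := by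
    intro a ha
    rw [Submodule.Quotient.mk_smul, hg₀, ← map_smul]
    congr 1
    change Submodule.Quotient.mk (MulOpposite.op a • (⟨e i, hmem _ hid⟩ : projectiveIdeal e i)) = _
    congr 1
    exact Subtype.ext ha
  have hg : ∀ a, e i * a = a → (g₀ : A) * e i * a = g₀ * a := fun a ha => by rw [mul_assoc, ha]
  refine ⟨g₀ * e i, op_smul_mem g₀.2 _, by rw [mul_assoc, hid.eq], fun x hx => ?_,
    fun a ha => ?_⟩
  · obtain ⟨⟨a, ha⟩, haq⟩ := Submodule.Quotient.mk_surjective _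
      (φ (Submodule.Quotient.mk ⟨x, hx⟩))
    have ha' := (mem_span_idempotent hid).1 ha
    refine ⟨a, ha', ?_⟩
    have h1 : Submodule.Quotient.mk (⟨x, hx⟩ : F') =
        Submodule.Quotient.mk (p := F.submoduleOf F') (MulOpposite.op a • g₀) := by
      rw [hsmul a ha', LinearEquiv.eq_symm_apply]
      exact haq.symm
    rw [Submodule.Quotient.eq] at h1
    rw [hg a ha']
    exact h1
  · rw [hg a ha]
    have h1 : (g₀ : A) * a ∈ F ↔
        Submodule.Quotient.mk (p := F.submoduleOf F') (MulOpposite.op a • g₀) = 0 := by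
      rw [Submodule.Quotient.mk_eq_zero]; rfl
    rw [h1, hsmul a ha, LinearEquiv.map_eq_zero_iff]
    exact Submodule.Quotient.mk_eq_zero _

variable (K : Type*) [Field K] [Algebra K A]

/-- At the maximal index the sum of later idempotents is e_l alone. -/
theorem mem_properTraceIdeal_last_iff (he : IsCompletePrimitiveSeq e) {l : Fin n}
    (hl : ∀ j, j ≤ l) {x : A} : x ∈ properTraceIdeal e l ↔ x ∈ traceSpace K (e l) := by
  have hid := (he.2 l).1
  constructor
  · intro hx
    induction hx using Submodule.span_induction with
    | mem x hx =>
      obtain ⟨r, hr, rfl⟩ := hx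
      have : Finset.Ici l = {l} := by
        ext j
        rw [Finset.mem_Ici, Finset.mem_singleton]
        exact ⟨fun h => le_antisymm (hl j) h, fun h => h.ge⟩
      rw [this, Finset.sum_singleton, ← hid.eq, ← mul_assoc, hid.eq]
      refine Submodule.mul_mem_mul ⟨⟨?_, ?_⟩, mul_mem_jacobson hr _ _⟩ hid.eq
      · exact mul_mem_rightSpace (mul_mem_rightSpace (mem_rightSpace.2 hid.eq) _) _
      · exact mul_mem_leftSpace (mem_leftSpace.2 hid.eq) _
    | zero => exact Submodule.zero_mem _
    | add x y _ _ hx hy => exact Submodule.add_mem _ hx hy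
    | smul a x _ hx =>
      have h : traceSpace K (e l) * ⊤ ≤ traceSpace K (e l) := by
        rw [traceSpace, mul_assoc]
        refine mul_le_mul' le_rfl ?_
        rw [Submodule.mul_le]
        exact fun p hp b _ => mul_mem_rightSpace hp b
      exact h (Submodule.mul_mem_mul hx (Submodule.mem_top (x := a.unop)))
  · intro hx
    have : traceSpace K (e l) ≤ (properTraceIdeal e l).restrictScalars K := by
      rw [traceSpace, Submodule.mul_le]
      exact fun m hm p _ => op_smul_mem
        (mem_properTraceIdeal_of_mem_jacobson he le_rfl hm.2 hm.1.1 hm.1.2) p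
    exact this hx

variable [FiniteDimensional K A]

/-- A filtration by proper standard modules forces `A e A` to be large, for `e` the last
idempotent. -/
theorem finrank_leftSpace_mul_le (hA : IsBasicAlg A) (he : IsCompletePrimitiveSeq e) {l : Fin n}
    (hl : ∀ j, j ≤ l) (hF : IsFilteredBy (R := Aᵐᵒᵖ) (fun i => ProperStandard e i) A) {d δ : ℕ}
    (hd : finrank K (cornerSpace K (e l)) = finrank K (cornerRadical K (e l)) + d)
    (hδ : finrank K (rightSpace K (e l)) = finrank K (traceSpace K (e l)) + δ) :
    finrank K (leftSpace K (e l)) * δ ≤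
      d * finrank K (leftSpace K (e l) * rightSpace K (e l) : Submodule K A) := by
  have := IsArtinianRing.of_finite K A
  have := isNoetherian_op K A
  have := isArtinian_op K A
  obtain ⟨s, F, hF0, hFs, hF⟩ := hF
  -- The part of the filtration in Ae, along which the inequality is proved by induction.
  let G (k : ℕ) : Submodule K A := (F k).restrictScalars K ⊓ leftSpace K (e l)
  have hid := (he.2 l).1
  have hGF : ∀ k, G k * rightSpace K (e l) ≤ (F k).restrictScalars K := fun k => by
    rw [Submodule.mul_le]
    exact fun x hx p _ => op_smul_mem hx.1 p
  suffices h : ∀ k ≤ s, finrank K (G k) * δ ≤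
      d * finrank K (G k * rightSpace K (e l) : Submodule K A) by
    have h1 := h s le_rfl
    have h2 : G s = leftSpace K (e l) := by simp [G, hFs]
    rwa [h2] at h1
  intro k
  induction k with
  | zero =>
    intro _
    have h2 : G 0 = ⊥ := by simp [G, hF0]
    rw [h2]; simp
  | succ k ih =>
    intro hk
    have ih := ih (Nat.le_of_succ_le hk)
    obtain ⟨hle, i, ⟨φ⟩⟩ := hF k hk
    have hGle : G k ≤ G (k + 1) := inf_le_inf_right _ hle
    obtain ⟨g, hgF, hgi, hgen, hgann⟩ := exists_generator_of_equiv he φ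
    have hgen' : ∀ x ∈ G (k + 1), ∃ a, e i * a = a ∧ x - g * (a * e l) ∈ F k := by
      intro x hx
      obtain ⟨a, ha, hxa⟩ := hgen x hx.1
      refine ⟨a, ha, ?_⟩
      have h1 := op_smul_mem hxa (e l)
      rwa [sub_mul, mem_leftSpace.1 hx.2, mul_assoc] at h1
    by_cases hil : i = l
    · subst hil
      have hgG : g ∈ G (k + 1) := ⟨hgF, hgi⟩
      have h1 := finrank_add_le_of_le_sup_map (LinearMap.mulLeft K g)
        (cornerRadical_le (K := K) (e := e i)) (X := G k) (Y := G (k + 1))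
        (by
          rintro _ ⟨r, hr, rfl⟩
          refine ⟨(hgann r hr.1.1).2 ?_, mul_mem_leftSpace hr.1.2 g⟩
          exact mem_properTraceIdeal_of_mem_jacobson he le_rfl hr.2 hr.1.1 hr.1.2)
        (by
          intro x hx
          obtain ⟨a, ha, hxa⟩ := hgen' x hx
          have hae : a * e i ∈ cornerSpace K (e i) :=
            ⟨mul_mem_rightSpace (mem_rightSpace.2 ha) _, mul_mem_leftSpace (mem_leftSpace.2 hid) a⟩
          rw [← sub_add_cancel x (g * (a * e i))]
          refine Submodule.add_mem_sup ⟨hxa, ?_⟩ ⟨_, hae, rfl⟩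
          exact Submodule.sub_mem _ hx.2 (mul_mem_leftSpace hae.2 g))
      have h2 := finrank_add_le_of_map_le (LinearMap.mulLeft K g)
        (X := G k * rightSpace K (e i)) (Y := G (k + 1) * rightSpace K (e i))
        (V' := rightSpace K (e i)) (U := traceSpace K (e i))
        (mul_le_mul' hGle le_rfl)
        (by
          rintro _ ⟨p, hp, rfl⟩
          exact Submodule.mul_mem_mul hgG hp)
        (fun p hp hgp => (mem_properTraceIdeal_last_iff K he hl).1
          ((hgann p hp).1 (hGF k hgp)))
      have h3 : finrank K (G (k + 1)) ≤ finrank K (G k) + d := by omega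
      have h4 : finrank K (G k * rightSpace K (e i) : Submodule K A) + δ ≤
        finrank K (G (k + 1) * rightSpace K (e i) : Submodule K A) := by omega
      have h5 := Nat.mul_le_mul_right δ h3
      have h6 := Nat.mul_le_mul_left d h4
      rw [add_mul] at h5
      rw [mul_add] at h6
      omega
    -- For i ≠ l, the space e_iAe_l lies in J, hence in the trace ideal since i ≤ l; so Δ̄(i)e_l =
    -- 0.
    · have hG : G (k + 1) = G k := by
        refine le_antisymm (fun x hx => ⟨?_, hx.2⟩) hGle
        obtain ⟨a, ha, hxa⟩ := hgen' x hx
        have h1 : e i * (a * e l) = a * e l := by rw [← mul_assoc, ha]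
        have h2 : a * e l * e l = a * e l := by rw [mul_assoc, hid.eq]
        have h3 := mem_jacobson_of_orthogonal hA (he.2 l) (he.2 i) (he.mul_eq_zero (Ne.symm hil))
          (he.mul_eq_zero hil) h1 h2
        have h4 := (hgann _ h1).2 (mem_properTraceIdeal_of_mem_jacobson he (hl i) h3 h1 h2)
        exact ((F k).sub_mem_iff_left h4).1 hxa
      rw [hG]; exact ih

end Sequence

/-! ### Selfinjectivity makes the last idempotent central. -/

section Selfinjective

open Module

variable {A : Type u} [Ring A] {n : ℕ} {e : Fin n → A}

theorem one_sub_mul_mem_jacobson [IsArtinianRing A] [IsNoetherian Aᵐᵒᵖ A] [IsArtinian Aᵐᵒᵖ A]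
    (hA : IsBasicAlg A) (he : IsCompletePrimitiveSeq e) (l : Fin n) (c : A) :
    (1 - e l) * c * e l ∈ Ring.jacobson A := by
  have h1 : 1 - e l = ∑ j ∈ Finset.univ.erase l, e j := by
    rw [← he.1.complete, ← Finset.add_sum_erase _ _ (Finset.mem_univ l), add_sub_cancel_left]
  rw [h1, Finset.sum_mul, Finset.sum_mul]
  refine Submodule.sum_mem _ fun j hj => ?_
  have hjl := Finset.ne_of_mem_erase hj
  exact mem_jacobson_of_orthogonal hA (he.2 l) (he.2 j) (he.mul_eq_zero hjl.symm)
    (he.mul_eq_zero hjl) (by rw [← mul_assoc, ← mul_assoc, (he.2 j).1.eq])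
    (by rw [mul_assoc, (he.2 l).1.eq])

theorem mul_one_sub_mem_jacobson [IsArtinianRing A] [IsNoetherian Aᵐᵒᵖ A] [IsArtinian Aᵐᵒᵖ A]
    (hA : IsBasicAlg A) (he : IsCompletePrimitiveSeq e) (l : Fin n) (c : A) :
    e l * c * (1 - e l) ∈ Ring.jacobson A := by
  have h1 : 1 - e l = ∑ j ∈ Finset.univ.erase l, e j := by
    rw [← he.1.complete, ← Finset.add_sum_erase _ _ (Finset.mem_univ l), add_sub_cancel_left]
  rw [h1, Finset.mul_sum]
  refine Submodule.sum_mem _ fun j hj => ?_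
  have hjl := Finset.ne_of_mem_erase hj
  exact mem_jacobson_of_orthogonal hA (he.2 j) (he.2 l) (he.mul_eq_zero hjl)
    (he.mul_eq_zero hjl.symm) (by rw [← mul_assoc, ← mul_assoc, (he.2 l).1.eq])
    (by rw [mul_assoc, (he.2 j).1.eq])

theorem exists_mul_jacobson_eq_zero [IsArtinianRing A] {x : A} (hx : x ≠ 0) :
    ∃ a, x * a ≠ 0 ∧ ∀ r ∈ Ring.jacobson A, x * a * r = 0 := by
  obtain ⟨k, hk⟩ := exists_jacobson_pow_eq_bot (A := A)
  by_contra! h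
  have key : ∀ m, ∃ a ∈ Ring.jacobson A ^ m, x * a ≠ 0 := by
    intro m
    induction m with
    | zero => exact ⟨1, by simp [Submodule.pow_zero], by rwa [mul_one]⟩
    | succ m ih =>
      obtain ⟨a, ha, hxa⟩ := ih
      obtain ⟨r, hr, har⟩ := h a hxa
      refine ⟨a * r, ?_, by rwa [← mul_assoc]⟩
      rw [Submodule.pow_succ]
      exact Ideal.mul_mem_mul ha hr
  obtain ⟨a, ha, hxa⟩ := key k
  rw [hk, Ideal.mem_bot] at ha
  exact hxa (by rw [ha, mul_zero])

/-- If two elements with the same annihilator lie in `f A` and `g A`, where `g A f` is in the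
radical, then they vanish. -/
theorem eq_zero_of_annihilator_eq [IsArtinianRing A] (h : IsSelfinjectiveAlg A) {e f g x y : A}
    (he : IsIdempotentElem e) (hxe : x * e = x) (hye : y * e = y) (hfx : f * x = x)
    (hgy : g * y = y) (hxy : ∀ a, e * a = a → (x * a = 0 ↔ y * a = 0))
    (hgf : ∀ c, g * c * f ∈ Ring.jacobson A) : x = 0 := by
  obtain ⟨c, hc⟩ := exists_mul_left_eq_corner h hxe hye hfx hgy (fun a ha => (hxy a ha).1) he
  obtain ⟨c', hc'⟩ := exists_mul_left_eq_corner h hye hxe hgy hfx (fun a ha => (hxy a ha).2) he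
  -- Going from x to y and back multiplies x by an element of J.
  refine eq_zero_of_mul_eq_self (Ideal.mul_mem_left _ (f * c' * g) (hgf c)) ?_
  rw [mul_assoc, hc, hc']

variable (K : Type*) [Field K] [Algebra K A] [FiniteDimensional K A]

include K in
theorem one_sub_mul_mul_eq_zero (hA : IsBasicAlg A) (hinj : IsSelfinjectiveAlg A)
    (he : IsCompletePrimitiveSeq e) {l : Fin n} (hl : ∀ j, j ≤ l)
    (hF : IsFilteredBy (R := Aᵐᵒᵖ) (fun i => ProperStandard e i) A) (b : A) :
    (1 - e l) * b * e l = 0 := by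
  have := IsArtinianRing.of_finite K A
  have := isNoetherian_op K A
  have := isArtinian_op K A
  have hid := (he.2 l).1
  obtain ⟨d, hd⟩ := Nat.exists_eq_add_of_le
    (Submodule.finrank_mono (cornerRadical_le (K := K) (e := e l)))
  obtain ⟨δ, hδ⟩ := Nat.exists_eq_add_of_le
    (Submodule.finrank_mono (traceSpace_le (K := K) (e := e l)))
  have hann : ∀ x, x * e l = x → x ≠ 0 → (∀ r ∈ cornerRadical K (e l), x * r = 0) →
      ∀ a, e l * a = a → (x * a = 0 ↔ a ∈ traceSpace K (e l)) := by
    intro x hxe hx0 hx a ha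
    refine ⟨fun hxa => mem_traceSpace_of_mul_eq_zero (he.2 l) hd hδ
      (finrank_leftSpace_mul_le K hA he hl hF hd hδ) hxe hx0 hx ha hxa, fun haT => ?_⟩
    have h6 : traceSpace K (e l) ≤ (LinearMap.mulLeft K x).ker := by
      rw [traceSpace, Submodule.mul_le]
      intro m hm p _
      rw [LinearMap.mem_ker, LinearMap.mulLeft_apply, ← mul_assoc, hx m hm, zero_mul]
    exact h6 haT
  have hex : ∀ f : A, (∃ y, y ≠ 0 ∧ f * y = y ∧ y * e l = y) →
      ∃ y, y ≠ 0 ∧ f * y = y ∧ y * e l = y ∧ ∀ r ∈ cornerRadical K (e l), y * r = 0 := by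
    rintro f ⟨y₀, hy₀, hy₁, hy₂⟩
    obtain ⟨y, hy, hy0, hyN⟩ := exists_mul_cornerRadical_le (e := e l) (X := ⊥)
      (Y := rightSpace K f ⊓ leftSpace K (e l))
      (bot_lt_iff_ne_bot.2 fun h => hy₀ ((Submodule.mem_bot K).1 (h ▸ ⟨hy₁, hy₂⟩))) (by
        rw [Submodule.mul_le]
        exact fun m hm q hq => ⟨mul_mem_rightSpace hm.1 q, mul_mem_leftSpace hq.2 m⟩)
    exact ⟨y, hy0, hy.1, hy.2, fun r hr => (Submodule.mem_bot K).1 (hyN ⟨r, hr, rfl⟩)⟩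
  by_contra hb
  -- x is taken in eAe and y in (1-e)Ae; both have annihilator eJeA in eA.
  obtain ⟨x, hx0, hx1, hx2, hx3⟩ := hex (e l) ⟨e l, (he.2 l).2.1, hid, hid⟩
  obtain ⟨y, hy0, hy1, hy2, hy3⟩ := hex (1 - e l) ⟨_, hb, by
    rw [← mul_assoc, ← mul_assoc, hid.one_sub.eq], by rw [mul_assoc, hid.eq]⟩
  exact hx0 (eq_zero_of_annihilator_eq hinj hid hx2 hy2 hx1 hy1
    (fun a ha => (hann x hx2 hx0 hx3 a ha).trans (hann y hy2 hy0 hy3 a ha).symm)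
    (one_sub_mul_mem_jacobson hA he l))

omit [Algebra K A] [FiniteDimensional K A] [Field K] in
/-- The Nakayama permutation: every primitive idempotent of the sequence supports the socle of
some indecomposable projective. -/
theorem exists_socle_element [IsArtinianRing A] [IsNoetherian Aᵐᵒᵖ A] [IsArtinian Aᵐᵒᵖ A]
    (hA : IsBasicAlg A) (hinj : IsSelfinjectiveAlg A) (he : IsCompletePrimitiveSeq e) (l : Fin n) :
    ∃ i t, t ≠ 0 ∧ e i * t = t ∧ t * e l = t ∧ ∀ r ∈ Ring.jacobson A, t * r = 0 := by
  have h1 : ∀ i, ∃ j t, t ≠ 0 ∧ e i * t = t ∧ t * e j = t ∧ ∀ r ∈ Ring.jacobson A, t * r = 0 := by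
    intro i
    obtain ⟨a, ha0, ha⟩ := exists_mul_jacobson_eq_zero (he.2 i).2.1
    have : ∃ j, e i * a * e j ≠ 0 := by
      by_contra! h
      apply ha0
      rw [← mul_one (e i * a), ← he.1.complete, Finset.mul_sum]
      exact Finset.sum_eq_zero fun j _ => h j
    obtain ⟨j, hj⟩ := this
    refine ⟨j, _, hj, by rw [← mul_assoc, ← mul_assoc, (he.2 i).1.eq],
      by rw [mul_assoc, (he.2 j).1.eq], fun r hr => ?_⟩
    rw [mul_assoc]
    exact ha _ (Ideal.mul_mem_left _ _ hr)
  choose σ t ht0 ht1 ht2 ht3 using h1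
  have hann : ∀ i a, e (σ i) * a = a → (t i * a = 0 ↔ a ∈ Ring.jacobson A) := by
    refine fun i a ha => ⟨fun h => ?_, ht3 i a⟩
    by_contra haJ
    obtain ⟨y, hy⟩ := exists_mul_eq_of_notMem_jacobson (he.2 (σ i)) ha haJ
    exact ht0 i (by rw [← ht2, ← hy, ← mul_assoc, h, zero_mul])
  -- Socle elements of the same type have equal annihilators, so distinct i and j would make them
  -- vanish. On a finite index set injectivity yields surjectivity.
  have hσ : Function.Injective σ := by
    intro i j hij
    by_contra hne
    refine ht0 i (eq_zero_of_annihilator_eq hinj (he.2 (σ i)).1 (ht2 i) (y := t j)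
      (by rw [hij, ht2]) (ht1 i) (ht1 j)
      (fun a ha => (hann i a ha).trans (hann j a (hij ▸ ha)).symm) fun c => ?_)
    exact mem_jacobson_of_orthogonal hA (he.2 i) (he.2 j) (he.mul_eq_zero hne)
      (he.mul_eq_zero (Ne.symm hne)) (by rw [← mul_assoc, ← mul_assoc, (he.2 j).1.eq])
      (by rw [mul_assoc, (he.2 i).1.eq])
  obtain ⟨i, rfl⟩ := Finite.surjective_of_injective hσ l
  exact ⟨i, t i, ht0 i, ht1 i, ht2 i, ht3 i⟩

omit [Algebra K A] [FiniteDimensional K A] [Field K] in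
theorem mul_mul_one_sub_eq_zero [IsArtinianRing A] [IsNoetherian Aᵐᵒᵖ A] [IsArtinian Aᵐᵒᵖ A]
    (hA : IsBasicAlg A) (hinj : IsSelfinjectiveAlg A) (he : IsCompletePrimitiveSeq e) {l : Fin n}
    (hl : ∀ b, (1 - e l) * b * e l = 0) (b : A) : e l * b * (1 - e l) = 0 := by
  obtain ⟨i, t, ht0, ht1, ht2, ht3⟩ := exists_socle_element hA hinj he l
  have hid := (he.2 l).1
  have hil : i = l := by
    by_contra hil
    apply ht0
    have h1 := hl t
    rwa [mul_assoc, ht2, sub_mul, one_mul, ← ht1, ← mul_assoc, he.mul_eq_zero (Ne.symm hil),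
      zero_mul, sub_zero, ht1] at h1
  subst hil
  set p := e i * b * (1 - e i) with hp
  have htmul : ∀ a, t * a * e i = t * a := fun a => by
    have h1 := ht3 _ (mul_one_sub_mem_jacobson hA he i a)
    rw [← mul_assoc, ← mul_assoc, ht2, mul_sub, mul_one, sub_eq_zero] at h1
    exact h1.symm
  have hpmul : ∀ a, p * a * e i = 0 := fun a => by
    rw [hp, mul_assoc, mul_assoc, ← mul_assoc (1 - e i), hl, mul_zero]
  -- Right multiplication by e is A-linear on tA + pA: tA ⊆ Ae because tJ = 0, and pAe = 0. Hence it
  -- is left multiplication by some c, which fixes t and kills p.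
  let I : Submodule Aᵐᵒᵖ A := Submodule.span Aᵐᵒᵖ {t} ⊔ Submodule.span Aᵐᵒᵖ {p}
  have hI : ∀ x ∈ I, ∀ r, x * r * e i = x * e i * r := by
    intro x hx r
    obtain ⟨y, hy, z, hz, rfl⟩ := Submodule.mem_sup.1 hx
    obtain ⟨a, rfl⟩ := mem_span_singleton_op.1 hy
    obtain ⟨a', rfl⟩ := mem_span_singleton_op.1 hz
    simp only [add_mul]
    rw [mul_assoc t, htmul, htmul, mul_assoc p, hpmul, hpmul, zero_mul, mul_assoc t]
  obtain ⟨c, hc⟩ := exists_forall_eq_mul_left hinj (I := I)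
    { toFun := fun x => x * e i
      map_add' := fun x y => add_mul _ _ _
      map_smul' := fun r x => hI x x.2 r.unop }
  have hct : c * t = t :=
    (hc ⟨t, Submodule.mem_sup_left (Submodule.mem_span_singleton_self t)⟩).symm.trans ht2
  have hcp : c * p = 0 :=
    (hc ⟨p, Submodule.mem_sup_right (Submodule.mem_span_singleton_self p)⟩).symm.trans
      (by simpa using hpmul 1)
  have hep : e i * p = p := by rw [hp, ← mul_assoc, ← mul_assoc, hid.eq]
  -- ece fixes t ≠ 0, so it is outside J and invertible in eAe; since it kills p, p = 0.
  obtain ⟨y, -, -, -, hy⟩ := exists_inverse_of_notMem_jacobson (he.2 i) (x := e i * c * e i)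
    (by rw [← mul_assoc, ← mul_assoc, hid.eq]) (by rw [mul_assoc, hid.eq]) fun hJ =>
      ht0 (eq_zero_of_mul_eq_self hJ (by rw [mul_assoc, ht1, mul_assoc, hct, ht1]))
  rw [← hep, ← hy, mul_assoc, mul_assoc, hep, mul_assoc, hcp, mul_zero, mul_zero]

include K in
theorem isLocalRing_of_isStandardlyStratified (hconn : IsConnectedAlg A) (hA : IsBasicAlg A)
    (hinj : IsSelfinjectiveAlg A) (h : IsStandardlyStratified A) : IsLocalRing A := by
  have := IsArtinianRing.of_finite K A
  have := isNoetherian_op K A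
  have := isArtinian_op K A
  obtain ⟨hnt, hconn⟩ := hconn
  obtain ⟨n, e, he, hF⟩ := h
  cases n with
  | zero => exact absurd he.1.complete (by simp)
  | succ n =>
    have h1 := one_sub_mul_mul_eq_zero K hA hinj he (l := Fin.last n) Fin.le_last hF
    have h2 := mul_mul_one_sub_eq_zero hA hinj he h1
    have hp := he.2 (Fin.last n)
    have h3 := hconn _ hp.1 fun a => by
      have h4 := h1 a
      have h5 := h2 a
      rw [sub_mul, sub_mul, one_mul, sub_eq_zero] at h4
      rw [mul_sub, mul_one, sub_eq_zero] at h5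
      exact h5.trans h4.symm
    have h4 := h3.resolve_left hp.2.1
    rw [h4] at hp
    have h5 : ∀ x : A, IsNilpotent x ∨ IsUnit x := fun x =>
      (isNilpotent_or_exists_inverse hp (one_mul x) (mul_one x)).imp_right
        fun ⟨y, _, _, hxy, hyx⟩ => ⟨⟨x, y, hxy, hyx⟩, rfl⟩
    exact ⟨fun {a b} hab => (h5 a).symm.imp_right fun ha =>
      eq_sub_of_add_eq' hab ▸ ha.isUnit_one_sub⟩

end Selfinjective

/-! ### Finite global dimension and semisimplicity. -/

section GlobalDimension

open CategoryTheory

variable {R : Type u} [Ring R]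

/-- P is a direct summand of a finite power of R. -/
theorem injective_of_finite_projective [Module.Injective R R] (P : Type u) [AddCommGroup P]
    [Module R P] [Module.Finite R P] [Module.Projective R P] : Module.Injective R P := by
  obtain ⟨m, f, hf⟩ := Module.Finite.exists_fin' R P
  obtain ⟨s, hs⟩ := Module.projective_lifting_property f LinearMap.id hf
  refine ⟨fun X Y _ _ _ _ i hi g => ?_⟩
  obtain ⟨h, hh⟩ := Module.Injective.out (self := Module.Injective.pi R fun _ : Fin m => R)
    i hi (s ∘ₗ g)
  refine ⟨f ∘ₗ h, fun x => ?_⟩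
  rw [LinearMap.comp_apply, hh]
  exact LinearMap.congr_fun hs (g x)

/-- An injective kernel splits off, leaving M as a summand of F. -/
theorem projective_of_injective_ker {F M : Type u} [AddCommGroup F] [Module R F]
    [AddCommGroup M] [Module R M] [Module.Projective R F] {f : F →ₗ[R] M}
    (hf : Function.Surjective f) (h : Module.Injective R f.ker) : Module.Projective R M := by
  obtain ⟨r, hr⟩ := h.out f.ker.subtype f.ker.injective_subtype LinearMap.id
  let s := (f.ker.liftQ (LinearMap.id - f.ker.subtype ∘ₗ r) fun x hx => by
    have := hr ⟨x, hx⟩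
    simp only [Submodule.subtype_apply, LinearMap.id_apply] at this
    simp [this]) ∘ₗ (f.quotKerEquivOfSurjective hf).symm.toLinearMap
  refine Module.Projective.of_split s f (LinearMap.ext fun y => ?_)
  obtain ⟨x, rfl⟩ := hf y
  have h1 : (f.quotKerEquivOfSurjective hf).symm (f x) = Submodule.Quotient.mk x := by
    rw [LinearEquiv.symm_apply_eq]; rfl
  simp [s, h1]

/-- Over a Noetherian selfinjective ring, finitely generated modules of finite projective
dimension are projective. -/
theorem projective_of_hasProjectiveDimensionLT [IsNoetherianRing R] [Module.Injective R R] (n : ℕ)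
    (M : Type u) [AddCommGroup M] [Module R M] [Module.Finite R M]
    (h : HasProjectiveDimensionLT (ModuleCat.of R M) n) : Module.Projective R M := by
  induction n generalizing M with
  | zero =>
    have : HasProjectiveDimensionLT (ModuleCat.of R M) 1 := inferInstance
    rw [← projective_iff_hasProjectiveDimensionLT_one, ← IsProjective.iff_projective] at this
    exact this
  | succ n ih =>
    cases n with
    | zero =>
      rw [zero_add, ← projective_iff_hasProjectiveDimensionLT_one,
        ← IsProjective.iff_projective] at h
      exact h
    | succ n =>
      obtain ⟨m, f, hf⟩ := Module.Finite.exists_fin' R M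
      have hS := LinearMap.shortExact_shortComplexKer hf
      have hproj : Projective (ModuleCat.of R (Fin m → R)) :=
        (IsProjective.iff_projective _).1 inferInstance
      -- Dimension shifting: the kernel is projective by induction, hence injective, so the cover
      -- splits.
      have h1 := (hS.hasProjectiveDimensionLT_X₃_iff n hproj).1 h
      have h2 := ih f.ker h1
      exact projective_of_injective_ker hf (injective_of_finite_projective _)

theorem isSemisimpleRing_of_forall_projective
    (h : ∀ (M : Type u) [AddCommGroup M] [Module R M] [Module.Finite R M],
      Module.Projective R M) : IsSemisimpleRing R := by
  refine (isSemisimpleModule_iff R R).2 ⟨fun p => ?_⟩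
  have := h (R ⧸ p)
  obtain ⟨s, hs⟩ := Module.projective_lifting_property p.mkQ LinearMap.id p.mkQ_surjective
  refine ⟨_, LinearMap.isCompl_of_proj
    (f := (LinearMap.id - s ∘ₗ p.mkQ).codRestrict p fun x => ?_) fun x => Subtype.ext ?_⟩
  rotate_left
  · have := LinearMap.congr_fun hs (p.mkQ x)
    rw [← Submodule.Quotient.mk_eq_zero p]
    change p.mkQ _ = 0
    rw [LinearMap.sub_apply, map_sub, LinearMap.id_apply]
    rw [LinearMap.comp_apply, LinearMap.id_apply] at this
    rw [LinearMap.comp_apply, this, sub_self]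
  · have : p.mkQ x = 0 := by simp
    simp [this]

theorem isSemisimpleRing_of_globalDimension_lt_top {A : Type u} [Ring A]
    [IsNoetherian Aᵐᵒᵖ A] (hinj : IsSelfinjectiveAlg A) (h : globalDimension A < ⊤) :
    IsSemisimpleRing A := by
  have : IsNoetherianRing Aᵐᵒᵖ := isNoetherian_of_linearEquiv (regularEquiv A).symm
  have hinj' : Module.Injective Aᵐᵒᵖ A := hinj
  have : Module.Injective Aᵐᵒᵖ Aᵐᵒᵖ :=
    Module.Baer.iff_injective.1 ((Module.Baer.congr (regularEquiv A)).2
      (Module.Baer.iff_injective.2 hinj'))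
  obtain ⟨n, hn⟩ : ∃ n : ℕ, globalDimension A < n := by
    generalize globalDimension A = g at h
    induction g with
    | bot => exact ⟨0, WithBot.bot_lt_coe _⟩
    | coe g =>
      cases g with
      | top => exact absurd h (lt_irrefl _)
      | coe m => exact ⟨m + 1, by exact_mod_cast Nat.lt_succ_self m⟩
  -- Right modules give semisimplicity of `Aᵐᵒᵖ`, which is a left-right symmetric property.
  rw [← isSemisimpleRing_mulOpposite_iff]
  refine isSemisimpleRing_of_forall_projective fun M _ _ _ =>
    projective_of_hasProjectiveDimensionLT n M ?_
  rw [← projectiveDimension_lt_iff]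
  refine lt_of_le_of_lt ?_ hn
  exact le_iSup₂_of_le (ModuleCat.of Aᵐᵒᵖ M) ‹Module.Finite Aᵐᵒᵖ M› le_rfl

end GlobalDimension

/-! ### Local algebras are standardly stratified. -/

section Local

variable {A : Type u} [Ring A]

theorem isPrimitiveIdempotent_one [IsLocalRing A] : IsPrimitiveIdempotent (1 : A) := by
  refine ⟨IsIdempotentElem.one, one_ne_zero, fun f g _ _ hfg hgf h => ?_⟩
  rcases IsLocalRing.isUnit_or_isUnit_of_add_one h.symm with hu | hu
  · exact Or.inr (hu.mul_right_eq_zero.1 hfg)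
  · exact Or.inl (hu.mul_right_eq_zero.1 hgf)

theorem isCompletePrimitiveSeq_one [IsLocalRing A] :
    IsCompletePrimitiveSeq (fun _ : Fin 1 => (1 : A)) :=
  ⟨⟨⟨fun _ => IsIdempotentElem.one, fun i j h => absurd (Subsingleton.elim i j) h⟩, by simp⟩,
    fun _ => isPrimitiveIdempotent_one⟩

theorem mem_properTraceIdeal_one_iff [IsLocalRing A] {a : A} :
    a ∈ properTraceIdeal (fun _ : Fin 1 => (1 : A)) 0 ↔ a ∈ Ring.jacobson A := by
  constructor
  · intro h
    induction h using Submodule.span_induction with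
    | mem x hx =>
      obtain ⟨r, hr, rfl⟩ := hx
      exact mul_mem_jacobson hr _ _
    | zero => exact Submodule.zero_mem _
    | add x y _ _ hx hy => exact Submodule.add_mem _ hx hy
    | smul c x _ hx => exact Ideal.mul_mem_right c.unop _ hx
  · exact fun h => mem_properTraceIdeal_of_mem_jacobson isCompletePrimitiveSeq_one le_rfl h
      (one_mul a) (mul_one a)

/-- Over a local Artinian ring the only simple right module is `A / J`. -/
theorem nonempty_equiv_properStandard_one [IsLocalRing A] [IsArtinianRing A]
    [IsNoetherian Aᵐᵒᵖ A] [IsArtinian Aᵐᵒᵖ A] (N : Type*) [AddCommGroup N] [Module Aᵐᵒᵖ N]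
    [IsSimpleModule Aᵐᵒᵖ N] :
    Nonempty (N ≃ₗ[Aᵐᵒᵖ] ProperStandard (fun _ : Fin 1 => (1 : A)) 0) := by
  have := IsSimpleModule.nontrivial Aᵐᵒᵖ N
  obtain ⟨x, hx⟩ := exists_ne (0 : N)
  let ψ : projectiveIdeal (fun _ : Fin 1 => (1 : A)) 0 →ₗ[Aᵐᵒᵖ] N :=
    LinearMap.toSpanSingleton Aᵐᵒᵖ N x ∘ₗ (regularEquiv A).symm.toLinearMap ∘ₗ
      Submodule.subtype _
  have hψ : ∀ a, ψ a = MulOpposite.op (a : A) • x := fun a => rfl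
  have hmem : ∀ a : A, a ∈ projectiveIdeal (fun _ : Fin 1 => (1 : A)) 0 := fun a =>
    mem_span_singleton_op.2 ⟨a, one_mul a⟩
  have hsurj : Function.Surjective ψ := by
    refine (LinearMap.surjective_or_eq_zero ψ).resolve_right fun h => hx ?_
    have h1 := hψ ⟨1, hmem 1⟩
    rw [h] at h1
    simpa using h1.symm
  have hker : ψ.ker = (properTraceIdeal (fun _ : Fin 1 => (1 : A)) 0).submoduleOf
      (projectiveIdeal (fun _ : Fin 1 => (1 : A)) 0) := by
    ext ⟨a, ha⟩
    rw [LinearMap.mem_ker, hψ, Submodule.submoduleOf, Submodule.mem_comap, Submodule.subtype_apply,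
      mem_properTraceIdeal_one_iff]
    constructor
    · intro h
      by_contra haJ
      obtain ⟨y, -, -, hy, -⟩ := exists_inverse_of_notMem_jacobson isPrimitiveIdempotent_one
        (one_mul a) (mul_one a) haJ
      apply hx
      rw [← one_smul Aᵐᵒᵖ x, ← MulOpposite.op_one, ← hy, MulOpposite.op_mul, mul_smul, h, smul_zero]
    · intro haJ
      -- A nonzero xa would generate the simple module N, so x would be fixed by a nilpotent
      -- element.
      by_contra h
      obtain ⟨c, hc⟩ := IsSimpleModule.toSpanSingleton_surjective Aᵐᵒᵖ h x
      rw [LinearMap.toSpanSingleton_apply, smul_smul] at hc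
      have h1 : IsUnit (1 - c * MulOpposite.op a) := by
        have h2 : IsNilpotent (a * c.unop) :=
          isNilpotent_of_mem_jacobson (Ideal.mul_mem_right _ _ haJ)
        have h3 := h2.isUnit_one_sub.op
        simpa using h3
      apply hx
      rw [← h1.smul_eq_zero, sub_smul, one_smul, hc, sub_self]
  exact ⟨((Submodule.quotEquivOfEq _ _ hker.symm).trans
    (ψ.quotKerEquivOfSurjective hsurj)).symm⟩

theorem isStandardlyStratified_of_isLocalRing [IsLocalRing A] [IsArtinianRing A]
    [IsNoetherian Aᵐᵒᵖ A] [IsArtinian Aᵐᵒᵖ A] : IsStandardlyStratified A := by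
  refine ⟨1, fun _ => 1, isCompletePrimitiveSeq_one, ?_⟩
  obtain ⟨F, hF0, s, hFs, hF⟩ :=
    exists_covBy_seq_of_wellFoundedLT_wellFoundedGT (Submodule Aᵐᵒᵖ A)
  refine ⟨s, F, hF0.eq_bot, hFs.eq_top, fun k hk => ⟨(hF k hk).le, 0, ?_⟩⟩
  have : IsSimpleModule Aᵐᵒᵖ (↥(F (k + 1)) ⧸ (F k).submoduleOf (F (k + 1))) :=
    (covBy_iff_quot_is_simple (hF k hk).le).1 (hF k hk)
  exact nonempty_equiv_properStandard_one _

end Local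

end StdStrat

theorem lemma3p1 {K : Type*} [Field K] {A : Type*} [Ring A] [Algebra K A]
    [FiniteDimensional K A] (hns : ¬ IsSemisimpleRing A) (hconn : StdStrat.IsConnectedAlg A)
    (hbasic : StdStrat.IsBasicAlg A) (hinj : StdStrat.IsSelfinjectiveAlg A) :
    (StdStrat.IsStandardlyStratified A ↔ IsLocalRing A) ∧ ¬ StdStrat.IsQuasiHereditary A := by
  have := IsArtinianRing.of_finite K A
  have := StdStrat.isNoetherian_op K A
  have := StdStrat.isArtinian_op K A
  exact ⟨⟨StdStrat.isLocalRing_of_isStandardlyStratified K hconn hbasic hinj,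
    fun _ => StdStrat.isStandardlyStratified_of_isLocalRing⟩,
    fun h => hns (StdStrat.isSemisimpleRing_of_globalDimension_lt_top hinj h.2)⟩
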